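/- Let $X$ be a locally compact Hausdorff totally disconnected topological space, let $G$ be a discrete group with identity $\varepsilon$, and let $K$ be a field. Let $\phi=(\phi_g,X_g,X)_{g\in G}$ be a partial action of $G$ on $X$: each $X_g\subseteq X$ is open, each $\phi_g\colon X_{g^{-1}}\to X_g$ is a homeomorphism, $X_\varepsilon=X$ and $\phi_\varepsilon=\mathrm{id}_X$, $\phi_g(X_{g^{-1}}\cap X_h)=X_g\cap X_{gh}$ for all $g,h\in G$, and $\phi_g(\phi_h(x))=\phi_{gh}(x)$ for all $g,h\in G$ and $x\in X_{h^{-1}}\cap X_{h^{-1}g^{-1}}$. Let $\mathcal G_X=\bigcup_{g\in G}\{g\}\times X_g$, with the topology inherited from $G\times X$, be the associated ample Hausdorff groupoid, with $d(g,x)=(\varepsilon,\phi_{g^{-1}}(x))$, $r(g,x)=(\varepsilon,x)$, $(g,x)^{-1}=(g^{-1},\phi_{g^{-1}}(x))$ and $(g,x)(h,y)=(gh,x)$ whenever $d(g,x)=r(h,y)$. Let $A=A_K(\mathcal G_X)$ be its Steinberg algebra, that is, the $K$-algebra of compactly supported locally constant functions $\mathcal G_X\to K$ with the convolution product $(f*f')(\gamma)=\sum_{\alpha\beta=\gamma}f(\alpha)f'(\beta)$,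 and for $g\in G$ let $A_g=\{f\in A: \operatorname{supp}(f)\subseteq\{g\}\times X_g\}$. Then $A$ is a $G$-graded von Neumann regular algebra: $A=\bigoplus_{g\in G}A_g$, $A_gA_h\subseteq A_{gh}$ for all $g,h\in G$, and for every $g\in G$ and every $f\in A_g$ there is $f'\in A$ with $f*f'*f=f$. -/

import Mathlib

open Set Topology

/-! ### Groupoids, described by their arrows -/

/-- A groupoid, given by its set of arrows. `dom a = a⁻¹ a` and `ran a = a a⁻¹` are the domain and
the range of `a`, viewed as unit arrows; `comp a b` is defined exactly when `dom a = ran b`. -/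
class ArrowGroupoid (𝒢 : Type*) extends Inv 𝒢 where
  dom : 𝒢 → 𝒢
  ran : 𝒢 → 𝒢
  comp (a b : 𝒢) (h : dom a = ran b) : 𝒢
  dom_comp (a b : 𝒢) (h : dom a = ran b) : dom (comp a b h) = dom b
  ran_comp (a b : 𝒢) (h : dom a = ran b) : ran (comp a b h) = ran a
  comp_assoc (a b c : 𝒢) (hab : dom a = ran b) (hbc : dom b = ran c) :
    comp (comp a b hab) c ((dom_comp a b hab).trans hbc) =
      comp a (comp b c hbc) (hab.trans (ran_comp b c hbc).symm)
  ran_dom (a : 𝒢) : ran (dom a) = dom a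
  dom_ran (a : 𝒢) : dom (ran a) = ran a
  comp_dom (a : 𝒢) : comp a (dom a) (ran_dom a).symm = a
  ran_comp_self (a : 𝒢) : comp (ran a) a (dom_ran a) = a
  dom_inv (a : 𝒢) : dom a⁻¹ = ran a
  ran_inv (a : 𝒢) : ran a⁻¹ = dom a
  inv_comp (a : 𝒢) : comp a⁻¹ a (dom_inv a) = dom a
  comp_inv (a : 𝒢) : comp a a⁻¹ (ran_inv a).symm = ran a

namespace ArrowGroupoid

section Basic

variable {𝒢 : Type*} [ArrowGroupoid 𝒢]

variable (𝒢) in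
/-- The unit space of a groupoid. -/
def units : Set 𝒢 := range (dom : 𝒢 → 𝒢)

/-- The domain map, as a map into the unit space. -/
def domUnit (a : 𝒢) : units 𝒢 := ⟨dom a, a, rfl⟩

/-- The range map, as a map into the unit space. -/
def ranUnit (a : 𝒢) : units 𝒢 := ⟨ran a, ran a, dom_ran a⟩

theorem comp_congr {a a' b b' : 𝒢} (ha : a = a') (hb : b = b') (h : dom a = ran b)
    (h' : dom a' = ran b') : comp a b h = comp a' b' h' := by
  subst ha; subst hb; rfl

theorem dom_dom (a : 𝒢) : dom (dom a) = dom a := by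
  have h := dom_comp a (dom a) (ran_dom a).symm
  rw [comp_dom] at h
  exact h.symm

theorem ran_ran (a : 𝒢) : ran (ran a) = ran a := by
  have h := ran_comp (ran a) a (dom_ran a)
  rw [ran_comp_self] at h
  exact h.symm

/-- The arrow `a⁻¹ c`, for arrows `a` and `c` with the same range. -/
def leftDiv (a c : 𝒢) (h : ran a = ran c) : 𝒢 := comp a⁻¹ c ((dom_inv a).trans h)

theorem ran_leftDiv (a c : 𝒢) (h : ran a = ran c) : ran (leftDiv a c h) = dom a := by
  rw [leftDiv, ran_comp, ran_inv]

theorem comp_leftDiv (a c : 𝒢) (h : ran a = ran c) :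
    comp a (leftDiv a c h) (ran_leftDiv a c h).symm = c := by
  have h1 := comp_assoc a a⁻¹ c (ran_inv a).symm ((dom_inv a).trans h)
  have h2 : comp (comp a a⁻¹ (ran_inv a).symm) c
      ((dom_comp a a⁻¹ (ran_inv a).symm).trans ((dom_inv a).trans h)) = c := by
    rw [comp_congr ((comp_inv a).trans h) rfl _ (dom_ran c), ran_comp_self]
  exact h1.symm.trans h2

theorem leftDiv_comp (a b : 𝒢) (h : dom a = ran b) :
    leftDiv a (comp a b h) (ran_comp a b h).symm = b := by
  have h1 := comp_assoc a⁻¹ a b (dom_inv a) h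
  have h2 : comp (comp a⁻¹ a (dom_inv a)) b ((dom_comp a⁻¹ a (dom_inv a)).trans h) = b := by
    rw [comp_congr ((inv_comp a).trans h) rfl _ (dom_ran b), ran_comp_self]
  exact h1.symm.trans h2

theorem leftDiv_leftDiv (a b c : 𝒢) (h : ran a = ran b) (h' : ran b = ran c) :
    leftDiv (leftDiv a b h) (leftDiv a c (h.trans h'))
      ((ran_leftDiv a b h).trans (ran_leftDiv a c (h.trans h')).symm) = leftDiv b c h' := by
  have key : comp (leftDiv a b h) (leftDiv b c h')
      ((dom_comp _ _ _).trans (ran_leftDiv b c h').symm) = leftDiv a c (h.trans h') := by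
    have h1 := comp_assoc a⁻¹ b (leftDiv b c h') ((dom_inv a).trans h) (ran_leftDiv b c h').symm
    exact h1.trans (comp_congr rfl (comp_leftDiv b c h') _ _)
  have h2 := leftDiv_comp (leftDiv a b h) (leftDiv b c h')
    ((dom_comp _ _ _).trans (ran_leftDiv b c h').symm)
  rw [← h2]
  congr 1
  exact key.symm

/-- Factorisations `c = a b` correspond to arrows `a` with the same range as `c`. -/
def factorEquiv (c : 𝒢) :
    {a : 𝒢 // ran a = ran c} ≃ {p : 𝒢 × 𝒢 // ∃ h : dom p.1 = ran p.2, comp p.1 p.2 h = c} where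
  toFun a := ⟨(a.1, leftDiv a.1 c a.2), (ran_leftDiv a.1 c a.2).symm, comp_leftDiv a.1 c a.2⟩
  invFun p := ⟨p.1.1, by
    obtain ⟨h, hp⟩ := p.2
    exact (ran_comp _ _ h).symm.trans (congrArg ran hp)⟩
  left_inv _ := rfl
  right_inv := by
    rintro ⟨⟨a, b⟩, h, rfl⟩
    simp only [Subtype.mk.injEq, Prod.mk.injEq, true_and]
    exact leftDiv_comp a b h

/-- Left translation by `a⁻¹`. -/
def translateEquiv (a c : 𝒢) (h : ran a = ran c) :
    {b : 𝒢 // ran b = ran c} ≃ {e : 𝒢 // ran e = ran (leftDiv a c h)} where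
  toFun b := ⟨leftDiv a b.1 (h.trans b.2.symm), by rw [ran_leftDiv, ran_leftDiv]⟩
  invFun e := ⟨comp a e.1 ((ran_leftDiv a c h).symm.trans e.2.symm), by rw [ran_comp, h]⟩
  left_inv b := Subtype.ext (comp_leftDiv a b.1 (h.trans b.2.symm))
  right_inv e := Subtype.ext (leftDiv_comp _ _ _)

end Basic

/-! ### Topological, étale and ample groupoids -/

section Topological

variable (𝒢 : Type*) [ArrowGroupoid 𝒢] [TopologicalSpace 𝒢]

/-- Inversion is continuous, and so is composition on the set of composable pairs. -/
class IsTopological : Prop where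
  continuous_inv : Continuous fun a : 𝒢 => a⁻¹
  continuous_comp :
    Continuous fun p : {p : 𝒢 × 𝒢 // dom p.1 = ran p.2} => comp p.1.1 p.1.2 p.2

/-- A topological groupoid is étale if its domain map is a local homeomorphism. -/
class IsEtale : Prop extends IsTopological 𝒢 where
  isLocalHomeomorph_dom : IsLocalHomeomorph (domUnit : 𝒢 → units 𝒢)

variable {𝒢} in
/-- An open set on which the domain and the range map are homeomorphisms onto open subsets of the
unit space. -/
structure IsOpenBisection (U : Set 𝒢) : Prop where
  isOpen : IsOpen U
  isOpenEmbedding_dom : IsOpenEmbedding fun a : U => domUnit (a : 𝒢)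
  isOpenEmbedding_ran : IsOpenEmbedding fun a : U => ranUnit (a : 𝒢)

/-- An étale groupoid is ample if the compact open bisections form a basis of its topology. -/
class IsAmple : Prop extends IsEtale 𝒢 where
  isTopologicalBasis : TopologicalSpace.IsTopologicalBasis {U : Set 𝒢 | IsCompact U ∧ IsOpenBisection U}

end Topological

end ArrowGroupoid

open ArrowGroupoid

/-- A grading of a topological groupoid by a discrete group: a continuous `1`-cocycle. -/
structure GroupoidGrading (𝒢 G : Type*) [ArrowGroupoid 𝒢] [TopologicalSpace 𝒢] [Group G]
    [TopologicalSpace G] where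
  toFun : 𝒢 → G
  continuous_toFun : Continuous toFun
  map_comp (a b : 𝒢) (h : dom a = ran b) : toFun (comp a b h) = toFun a * toFun b

/-! ### Steinberg algebras -/

section Convolution

variable {R 𝒢 : Type*} [CommRing R] [ArrowGroupoid 𝒢]

/-- The convolution product `(f * g)(c) = ∑_{ab = c} f(a) g(b)`. -/
noncomputable def groupoidConv (f g : 𝒢 → R) (c : 𝒢) : R :=
  ∑ᶠ p : {p : 𝒢 × 𝒢 // ∃ h : dom p.1 = ran p.2, comp p.1 p.2 h = c}, f p.1.1 * g p.1.2

theorem groupoidConv_apply (f g : 𝒢 → R) (c : 𝒢) :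
    groupoidConv f g c = ∑ᶠ a : {a : 𝒢 // ran a = ran c}, f a.1 * g (leftDiv a.1 c a.2) :=
  (finsum_comp_equiv (factorEquiv c)).symm

/-- Only finitely many arrows with a given range lie in the support of `f`. -/
def FiberFinite (f : 𝒢 → R) : Prop := ∀ x : 𝒢, {a : 𝒢 | ran a = x ∧ f a ≠ 0}.Finite

theorem FiberFinite.support {f : 𝒢 → R} (hf : FiberFinite f) (x : 𝒢) :
    (Function.support fun a : {a : 𝒢 // ran a = x} => f a.1).Finite := by
  refine ((hf x).preimage (f := ((↑) : {a : 𝒢 // ran a = x} → 𝒢))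
    Subtype.val_injective.injOn).subset fun a ha => ⟨a.2, ha⟩

theorem FiberFinite.support_mul {f : 𝒢 → R} (hf : FiberFinite f) (x : 𝒢)
    (k : {a : 𝒢 // ran a = x} → R) :
    (Function.support fun a : {a : 𝒢 // ran a = x} => f a.1 * k a).Finite :=
  (hf.support x).subset (Function.support_mul_subset_left _ _)

theorem groupoidConv_add_left {f f' : 𝒢 → R} (hf : FiberFinite f) (hf' : FiberFinite f')
    (g : 𝒢 → R) : groupoidConv (f + f') g = groupoidConv f g + groupoidConv f' g := by
  funext c
  simp only [groupoidConv_apply, Pi.add_apply, add_mul]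
  exact finsum_add_distrib (hf.support_mul _ _) (hf'.support_mul _ _)

theorem groupoidConv_add_right {f : 𝒢 → R} (hf : FiberFinite f)
    (g g' : 𝒢 → R) : groupoidConv f (g + g') = groupoidConv f g + groupoidConv f g' := by
  funext c
  simp only [groupoidConv_apply, Pi.add_apply, mul_add]
  exact finsum_add_distrib (hf.support_mul _ _) (hf.support_mul _ _)

theorem groupoidConv_zero_left (g : 𝒢 → R) : groupoidConv 0 g = 0 := by
  funext c; simp [groupoidConv_apply]

theorem groupoidConv_zero_right (f : 𝒢 → R) : groupoidConv f 0 = 0 := by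
  funext c; simp [groupoidConv_apply]

theorem groupoidConv_smul_left {f : 𝒢 → R} (hf : FiberFinite f) (k : R) (g : 𝒢 → R) :
    groupoidConv (k • f) g = k • groupoidConv f g := by
  funext c
  simp only [groupoidConv_apply, Pi.smul_apply, smul_eq_mul, mul_assoc]
  exact (mul_finsum' _ _ (hf.support_mul _ _)).symm

theorem groupoidConv_smul_right {f : 𝒢 → R} (hf : FiberFinite f) (k : R) (g : 𝒢 → R) :
    groupoidConv f (k • g) = k • groupoidConv f g := by
  funext c
  simp only [groupoidConv_apply, Pi.smul_apply, smul_eq_mul, mul_left_comm _ k]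
  exact (mul_finsum' _ _ (hf.support_mul _ _)).symm

theorem groupoidConv_assoc {f g : 𝒢 → R} (hf : FiberFinite f) (hg : FiberFinite g)
    (h : 𝒢 → R) :
    groupoidConv (groupoidConv f g) h = groupoidConv f (groupoidConv g h) := by
  classical
  funext c
  -- `S` holds the relevant first factors
  let S := (hf.support (ran c)).toFinset
  have hS : ∀ k : {a : 𝒢 // ran a = ran c} → R,
      ∑ᶠ b : {a : 𝒢 // ran a = ran c}, f b.1 * k b = ∑ b ∈ S, f b.1 * k b := fun k =>
    finsum_eq_sum_of_support_subset _ fun b hb => by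
      simp only [S, Finite.coe_toFinset]
      exact Function.support_mul_subset_left _ _ hb
  have hfg : ∀ a : {a : 𝒢 // ran a = ran c}, groupoidConv f g a.1 =
      ∑ b ∈ S, f b.1 * g (leftDiv b.1 a.1 (b.2.trans a.2.symm)) := by
    rintro ⟨a, ha⟩
    rw [← hS fun b => g (leftDiv b.1 a (b.2.trans ha.symm)), groupoidConv_apply]
    exact finsum_comp_equiv
      (f := fun b : {b : 𝒢 // ran b = ran c} => f b.1 * g (leftDiv b.1 a (b.2.trans ha.symm)))
      (Equiv.subtypeEquivRight fun b => by rw [ha])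
  have hfin : ∀ b : {a : 𝒢 // ran a = ran c},
      (Function.support fun a : {a : 𝒢 // ran a = ran c} =>
        f b.1 * g (leftDiv b.1 a.1 (b.2.trans a.2.symm)) * h (leftDiv a.1 c a.2)).Finite := by
    intro b
    refine ((hg.support (ran (leftDiv b.1 c b.2))).preimage
      (translateEquiv b.1 c b.2).injective.injOn).subset fun a ha => ?_
    intro h0
    apply ha
    have h0' : g (leftDiv b.1 a.1 (b.2.trans a.2.symm)) = 0 := h0
    simp only [h0', mul_zero, zero_mul]
  rw [groupoidConv_apply, groupoidConv_apply, hS fun b => groupoidConv g h (leftDiv b.1 c b.2)]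
  simp only [hfg, Finset.sum_mul]
  rw [finsum_sum_comm _ _ fun b _ => hfin b]
  refine Finset.sum_congr rfl fun b _ => ?_
  rw [groupoidConv_apply, ← finsum_comp_equiv (translateEquiv b.1 c b.2)]
  simp only [mul_assoc]
  rw [mul_finsum']
  · refine finsum_congr fun a => ?_
    exact congrArg (fun e => f b.1 * (g (leftDiv b.1 a.1 (b.2.trans a.2.symm)) * h e))
      (leftDiv_leftDiv b.1 a.1 c (b.2.trans a.2.symm) a.2).symm
  · refine ((hg.support (ran (leftDiv b.1 c b.2))).preimage
      (translateEquiv b.1 c b.2).injective.injOn).subset fun a ha => ?_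
    intro h0
    apply ha
    have h0' : g (translateEquiv b.1 c b.2 a).1 = 0 := h0
    simp [h0']

theorem groupoidConv_support_subset (f g : 𝒢 → R) (c : 𝒢) (hc : groupoidConv f g c ≠ 0) :
    ∃ a b : 𝒢, ∃ h : dom a = ran b, comp a b h = c ∧ f a ≠ 0 ∧ g b ≠ 0 := by
  by_contra! hcon
  apply hc
  refine (finsum_congr fun p => ?_).trans finsum_zero
  obtain ⟨⟨a, b⟩, h, hab⟩ := p
  by_cases hfa : f a = 0
  · simp [hfa]
  · simp [hcon a b h hab hfa]

end Convolution

theorem IsLocallyConstant.indicator_of_isClopen {R Y : Type*} [Zero R] [TopologicalSpace Y]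
    {f : Y → R} (hf : IsLocallyConstant f) {C : Set Y} (hC : IsClopen C) : IsLocallyConstant (C.indicator f) := by
  rw [IsLocallyConstant.iff_eventually_eq] at hf ⊢
  intro a
  by_cases ha : a ∈ C
  · filter_upwards [hf a, hC.isOpen.mem_nhds ha] with y hy hyC
    rw [indicator_of_mem hyC, indicator_of_mem ha, hy]
  · filter_upwards [hC.compl.isOpen.mem_nhds ha] with y hyC
    rw [indicator_of_notMem hyC, indicator_of_notMem ha]

theorem HasCompactSupport.indicator_set {R Y : Type*} [Zero R] [TopologicalSpace Y]
    {f : Y → R} (hf : HasCompactSupport f) (C : Set Y) : HasCompactSupport (C.indicator f) :=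
  hf.mono (by rw [support_indicator]; exact inter_subset_right)

section Ample

variable {R 𝒢 : Type*} [CommRing R] [ArrowGroupoid 𝒢] [TopologicalSpace 𝒢]

theorem ArrowGroupoid.continuous_dom [IsEtale 𝒢] : Continuous (dom : 𝒢 → 𝒢) :=
  continuous_subtype_val.comp (IsEtale.isLocalHomeomorph_dom (𝒢 := 𝒢)).continuous

theorem ArrowGroupoid.continuous_ran [IsEtale 𝒢] : Continuous (ran : 𝒢 → 𝒢) := by
  have h : (ran : 𝒢 → 𝒢) = fun a => dom a⁻¹ := funext fun a => (dom_inv a).symm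
  rw [h]
  exact continuous_dom.comp IsTopological.continuous_inv

/-- Every point has a compact open bisection around it. -/
theorem ArrowGroupoid.exists_bisection [IsAmple 𝒢] (a : 𝒢) :
    ∃ U : Set 𝒢, a ∈ U ∧ IsCompact U ∧ IsOpenBisection U := by
  obtain ⟨U, hU, haU, -⟩ := (IsAmple.isTopologicalBasis (𝒢 := 𝒢)).exists_subset_of_mem_open
    (mem_univ a) isOpen_univ
  exact ⟨U, haU, hU⟩

theorem ArrowGroupoid.IsOpenBisection.injOn_ran {U : Set 𝒢} (hU : IsOpenBisection U) :
    InjOn ran U := fun a ha b hb hab => by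
  have := hU.isOpenEmbedding_ran.injective (a₁ := ⟨a, ha⟩) (a₂ := ⟨b, hb⟩) (Subtype.ext hab)
  exact congrArg Subtype.val this

theorem HasCompactSupport.fiberFinite [IsAmple 𝒢] {f : 𝒢 → R} (hf : HasCompactSupport f) :
    FiberFinite f := by
  intro x
  choose U haU _ hU using exists_bisection (𝒢 := 𝒢)
  obtain ⟨t, -, ht⟩ := IsCompact.elim_nhds_subcover hf U
    fun a _ => (hU a).isOpen.mem_nhds (haU a)
  refine (t.finite_toSet.biUnion fun a _ =>
    (show ({b : 𝒢 | b ∈ U a ∧ ran b = x}).Subsingleton from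
      fun b hb c hc => (hU a).injOn_ran hb.1 hc.1 (hb.2.trans hc.2.symm)).finite).subset ?_
  rintro b ⟨hbx, hb⟩
  obtain ⟨a, hat, hab⟩ := mem_iUnion₂.1 (ht (subset_tsupport f hb))
  exact mem_iUnion₂.2 ⟨a, hat, hab, hbx⟩

variable [T2Space 𝒢]

theorem groupoidConv_hasCompactSupport [IsAmple 𝒢] {f g : 𝒢 → R} (hf : HasCompactSupport f)
    (hg : HasCompactSupport g) : HasCompactSupport (groupoidConv f g) := by
  have hcl : IsClosed {p : 𝒢 × 𝒢 | dom p.1 = ran p.2} :=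
    isClosed_eq (continuous_dom.comp continuous_fst) (continuous_ran.comp continuous_snd)
  have hK : IsCompact ((fun p : {p : 𝒢 × 𝒢 // dom p.1 = ran p.2} => comp p.1.1 p.1.2 p.2) ''
      (Subtype.val ⁻¹' (tsupport f ×ˢ tsupport g))) :=
    (hcl.isClosedEmbedding_subtypeVal.isCompact_preimage
      (IsCompact.prod hf hg)).image IsTopological.continuous_comp
  refine HasCompactSupport.of_support_subset_isCompact hK fun c hc => ?_
  obtain ⟨a, b, h, hab, ha, hb⟩ := groupoidConv_support_subset f g c hc
  exact ⟨⟨(a, b), h⟩, ⟨subset_tsupport f ha, subset_tsupport g hb⟩, hab⟩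

theorem groupoidConv_isLocallyConstant_of_bisection [IsAmple 𝒢] {f g : 𝒢 → R}
    (hf : IsLocallyConstant f) (hg : IsLocallyConstant g) {U : Set 𝒢} (hUc : IsCompact U)
    (hU : IsOpenBisection U) (hfU : ∀ a, a ∉ U → f a = 0) :
    IsLocallyConstant (groupoidConv f g) := by
  let ι : U → units 𝒢 := fun a => ranUnit (a : 𝒢)
  have hι : IsOpenEmbedding ι := hU.isOpenEmbedding_ran
  have hrc : Continuous (ranUnit : 𝒢 → units 𝒢) := continuous_ran.subtype_mk _
  let C : Set 𝒢 := ranUnit ⁻¹' range ι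
  have hCo : IsOpen C := hι.isOpen_range.preimage hrc
  have hCc : IsClosed C := by
    have := isCompact_iff_compactSpace.1 hUc
    exact (isCompact_range hι.continuous).isClosed.preimage hrc
  let s : C → U := fun c => hι.toIsEmbedding.toHomeomorph.symm ⟨ranUnit c.1, c.2⟩
  have hs : Continuous s := hι.toIsEmbedding.toHomeomorph.symm.continuous.comp
    ((hrc.comp continuous_subtype_val).subtype_mk _)
  have hsr : ∀ c : C, ran (s c : 𝒢) = ran (c : 𝒢) := fun c => by
    have h := hι.toIsEmbedding.toHomeomorph.apply_symm_apply ⟨ranUnit c.1, c.2⟩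
    exact congrArg (fun u : range ι => (u.1 : 𝒢)) h
  let q : C → 𝒢 := fun c => leftDiv (s c : 𝒢) (c : 𝒢) (hsr c)
  have hq : Continuous q :=
    (IsTopological.continuous_comp (𝒢 := 𝒢)).comp
      (((IsTopological.continuous_inv.comp (continuous_subtype_val.comp hs)).prodMk
        continuous_subtype_val).subtype_mk
          fun c : C => (dom_inv (s c : 𝒢)).trans (hsr c))
  have hval : ∀ c : C, groupoidConv f g c = f (s c) * g (q c) := by
    intro c
    rw [groupoidConv_apply]
    refine finsum_eq_single (fun a : {a : 𝒢 // ran a = ran (c : 𝒢)} =>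
      f a.1 * g (leftDiv a.1 c a.2)) ⟨s c, hsr c⟩ fun a ha => ?_
    have : a.1 ∉ U := fun haU => ha (Subtype.ext
      (hU.injOn_ran haU (s c).2 (a.2.trans (hsr c).symm)))
    simp only [hfU _ this, zero_mul]
  have hval0 : ∀ c, c ∉ C → groupoidConv f g c = 0 := by
    intro c hc
    rw [groupoidConv_apply]
    refine (finsum_congr fun a => ?_).trans finsum_zero
    have : a.1 ∉ U := fun haU => hc ⟨⟨a.1, haU⟩, Subtype.ext a.2⟩
    simp only [hfU _ this, zero_mul]
  have hlc : IsLocallyConstant fun c : C => f (s c) * g (q c) :=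
    IsLocallyConstant.mul (hf.comp_continuous (continuous_subtype_val.comp hs))
      (hg.comp_continuous hq)
  rw [IsLocallyConstant.iff_eventually_eq]
  intro c
  by_cases hc : c ∈ C
  · have h1 := (IsLocallyConstant.iff_eventually_eq _).1 hlc ⟨c, hc⟩
    have h2 : ∀ᶠ y : C in 𝓝 (⟨c, hc⟩ : C), groupoidConv f g y.1 = groupoidConv f g c := by
      filter_upwards [h1] with y hy
      rw [hval y, hy, ← hval ⟨c, hc⟩]
    have h3 := hCo.isOpenEmbedding_subtypeVal.map_nhds_eq ⟨c, hc⟩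
    change ∀ᶠ y in 𝓝 ((⟨c, hc⟩ : C) : 𝒢), groupoidConv f g y = groupoidConv f g c
    rw [← h3]
    exact h2
  · filter_upwards [hCc.isOpen_compl.mem_nhds hc] with y hy
    rw [hval0 y hy, hval0 c hc]

theorem groupoidConv_isLocallyConstant [IsAmple 𝒢] {f g : 𝒢 → R}
    (hf : IsLocallyConstant f) (hfc : HasCompactSupport f) (hg : IsLocallyConstant g) :
    IsLocallyConstant (groupoidConv f g) := by
  have key : ∃ C : Set 𝒢, IsClopen C ∧ tsupport f ⊆ C ∧ ∀ f' : 𝒢 → R, IsLocallyConstant f' →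
      HasCompactSupport f' → IsLocallyConstant (groupoidConv (C.indicator f') g) := by
    refine IsCompact.induction_on hfc (p := fun K => ∃ C : Set 𝒢, IsClopen C ∧ K ⊆ C ∧
      ∀ f' : 𝒢 → R, IsLocallyConstant f' → HasCompactSupport f' →
        IsLocallyConstant (groupoidConv (C.indicator f') g)) ?_ ?_ ?_ ?_
    · refine ⟨∅, isClopen_empty, Subset.rfl, fun f' _ _ => ?_⟩
      rw [indicator_empty']
      rw [groupoidConv_zero_left]
      exact IsLocallyConstant.const 0
    · rintro K L hKL ⟨C, hC, hLC, h⟩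
      exact ⟨C, hC, hKL.trans hLC, h⟩
    · rintro K L ⟨C, hC, hKC, h⟩ ⟨D, hD, hLD, h'⟩
      refine ⟨C ∪ D, hC.union hD, union_subset_union hKC hLD, fun f' hf' hfc' => ?_⟩
      have hsplit : (C ∪ D).indicator f' = C.indicator f' + D.indicator (Cᶜ.indicator f') := by
        funext a
        by_cases haC : a ∈ C <;> by_cases haD : a ∈ D <;> simp [haC, haD]
      rw [hsplit, groupoidConv_add_left (hfc'.indicator_set C).fiberFinite
        ((hfc'.indicator_set Cᶜ).indicator_set D).fiberFinite]
      exact (h f' hf' hfc').add (h' _ (hf'.indicator_of_isClopen hC.compl)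
        (hfc'.indicator_set Cᶜ))
    · intro a _
      obtain ⟨U, haU, hUc, hU⟩ := exists_bisection a
      have hUclopen : IsClopen U := ⟨hUc.isClosed, hU.isOpen⟩
      refine ⟨U, mem_nhdsWithin_of_mem_nhds (hU.isOpen.mem_nhds haU), U, hUclopen, Subset.rfl,
        fun f' hf' _ => ?_⟩
      exact groupoidConv_isLocallyConstant_of_bisection (hf'.indicator_of_isClopen hUclopen) hg
        hUc hU fun b hb => indicator_of_notMem hb _
  obtain ⟨C, -, hfC, h⟩ := key
  have := h f hf hfc
  rwa [indicator_eq_self.2 ((subset_tsupport f).trans hfC)] at this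

end Ample

section SteinbergAlgebra

variable (R 𝒢 : Type*) [CommRing R] [TopologicalSpace 𝒢]

/-- The compactly supported functions `𝒢 → R` that are continuous for the discrete topology
on `R`. -/
def steinbergSubmodule : Submodule R (𝒢 → R) where
  carrier := {f | IsLocallyConstant f ∧ HasCompactSupport f}
  add_mem' hf hg := ⟨hf.1.add hg.1, hf.2.add hg.2⟩
  zero_mem' := ⟨IsLocallyConstant.const 0, HasCompactSupport.zero⟩
  smul_mem' k _ hf := ⟨hf.1.comp (k • ·), hf.2.smul_left (f := fun _ => k)⟩

/-- The Steinberg algebra `A_R(𝒢)` of an ample Hausdorff groupoid: compactly supported locally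
constant functions under the convolution product. -/
def SteinbergAlgebra : Type _ := steinbergSubmodule R 𝒢

namespace SteinbergAlgebra

noncomputable instance : AddCommGroup (SteinbergAlgebra R 𝒢) :=
  inferInstanceAs (AddCommGroup (steinbergSubmodule R 𝒢))

noncomputable instance : Module R (SteinbergAlgebra R 𝒢) :=
  inferInstanceAs (Module R (steinbergSubmodule R 𝒢))

variable {R 𝒢}

/-- The underlying function of an element of the Steinberg algebra. -/
def toFun (f : SteinbergAlgebra R 𝒢) : 𝒢 → R :=
  Subtype.val (p := fun f => f ∈ steinbergSubmodule R 𝒢) f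

instance : CoeFun (SteinbergAlgebra R 𝒢) fun _ => 𝒢 → R := ⟨toFun⟩

/-- The element of the Steinberg algebra with underlying function `f`. -/
def mk (f : 𝒢 → R) (hf : IsLocallyConstant f) (hfc : HasCompactSupport f) :
    SteinbergAlgebra R 𝒢 := (⟨f, hf, hfc⟩ : steinbergSubmodule R 𝒢)

theorem coe_mk (f : 𝒢 → R) (hf : IsLocallyConstant f) (hfc : HasCompactSupport f) :
    (mk f hf hfc : 𝒢 → R) = f := rfl

theorem isLocallyConstant (f : SteinbergAlgebra R 𝒢) : IsLocallyConstant (f : 𝒢 → R) :=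
  (Subtype.property (p := fun f => f ∈ steinbergSubmodule R 𝒢) f).1

theorem hasCompactSupport (f : SteinbergAlgebra R 𝒢) : HasCompactSupport (f : 𝒢 → R) :=
  (Subtype.property (p := fun f => f ∈ steinbergSubmodule R 𝒢) f).2

theorem ext_fun {f g : SteinbergAlgebra R 𝒢} (h : (f : 𝒢 → R) = g) : f = g := Subtype.ext h

theorem coe_add (f g : SteinbergAlgebra R 𝒢) : ((f + g : SteinbergAlgebra R 𝒢) : 𝒢 → R) =
    (f : 𝒢 → R) + g := rfl

theorem coe_zero : ((0 : SteinbergAlgebra R 𝒢) : 𝒢 → R) = 0 := rfl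

theorem coe_smul (k : R) (f : SteinbergAlgebra R 𝒢) :
    ((k • f : SteinbergAlgebra R 𝒢) : 𝒢 → R) = k • (f : 𝒢 → R) := rfl

variable (R) in
/-- The functions of degree `g`: those supported on the arrows of degree `g`. -/
def homogeneousComponent {G : Type*} [Group G] [TopologicalSpace G]
    [ArrowGroupoid 𝒢] (c : GroupoidGrading 𝒢 G) (g : G) : Submodule R (SteinbergAlgebra R 𝒢) where
  carrier := {f | Function.support (f : 𝒢 → R) ⊆ c.toFun ⁻¹' {g}}
  add_mem' {f f'} hf hf' := (Function.support_add (f : 𝒢 → R) f').trans (union_subset hf hf')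
  zero_mem' := by simp [coe_zero]
  smul_mem' k f hf := (Function.support_const_smul_subset k (f : 𝒢 → R)).trans hf

variable [ArrowGroupoid 𝒢] [IsAmple 𝒢]

theorem fiberFinite (f : SteinbergAlgebra R 𝒢) : FiberFinite (f : 𝒢 → R) := f.hasCompactSupport.fiberFinite

variable [T2Space 𝒢]

noncomputable instance : Mul (SteinbergAlgebra R 𝒢) where
  mul f g := mk (groupoidConv f g)
    (groupoidConv_isLocallyConstant f.isLocallyConstant f.hasCompactSupport g.isLocallyConstant)
    (groupoidConv_hasCompactSupport f.hasCompactSupport g.hasCompactSupport)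

theorem coe_mul (f g : SteinbergAlgebra R 𝒢) : ((f * g : SteinbergAlgebra R 𝒢) : 𝒢 → R) =
    groupoidConv (f : 𝒢 → R) g := rfl

noncomputable instance : NonUnitalRing (SteinbergAlgebra R 𝒢) where
  left_distrib f g h := ext_fun (groupoidConv_add_right f.fiberFinite g h)
  right_distrib f g h := ext_fun (groupoidConv_add_left f.fiberFinite g.fiberFinite h)
  zero_mul f := ext_fun (groupoidConv_zero_left f)
  mul_zero f := ext_fun (groupoidConv_zero_right f)
  mul_assoc f g h := ext_fun (groupoidConv_assoc f.fiberFinite g.fiberFinite h)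

instance : IsScalarTower R (SteinbergAlgebra R 𝒢) (SteinbergAlgebra R 𝒢) where
  smul_assoc k f g := ext_fun (groupoidConv_smul_left f.fiberFinite k g)

instance : SMulCommClass R (SteinbergAlgebra R 𝒢) (SteinbergAlgebra R 𝒢) where
  smul_comm k f g := ext_fun (groupoidConv_smul_right f.fiberFinite k g).symm

end SteinbergAlgebra

end SteinbergAlgebra

/-! ### Graded von Neumann regular algebras -/

section Graded

variable {G K A : Type*} [Group G] [CommRing K] [NonUnitalRing A] [Module K A]

/-- `A = ⨁ g, 𝒜 g` with `𝒜 g * 𝒜 h ⊆ 𝒜 (g * h)`. -/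
structure IsGroupGraded (𝒜 : G → Submodule K A) : Prop where
  mul_mem : ∀ (g h : G) (x y : A), x ∈ 𝒜 g → y ∈ 𝒜 h → x * y ∈ 𝒜 (g * h)
  isInternal : open scoped Classical in DirectSum.IsInternal 𝒜

/-- A `G`-graded algebra in which every homogeneous `x` has the form `x = x * y * x`. -/
structure IsGradedVonNeumannRegular (𝒜 : G → Submodule K A) : Prop extends
    IsGroupGraded 𝒜 where
  regular : ∀ (g : G), ∀ x ∈ 𝒜 g, ∃ y : A, x * y * x = x

end Graded

/-! ### Partial actions and their transformation groupoids -/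

/-- A partial action of a group `G` on a topological space `X`, by homeomorphisms
`map g : X_{g⁻¹} → X_g` between open subsets of `X`. -/
structure PartialAction (G X : Type*) [Group G] [TopologicalSpace X] where
  /-- The open set `X_g`. -/
  set : G → Set X
  map : G → OpenPartialHomeomorph X X
  source_map (g : G) : (map g).source = set g⁻¹
  target_map (g : G) : (map g).target = set g
  set_one : set 1 = univ
  map_one (x : X) : map 1 x = x
  map_image (g h : G) : map g '' (set g⁻¹ ∩ set h) = set g ∩ set (g * h)
  map_map (g h : G) (x : X) (hx : x ∈ set h⁻¹ ∩ set (h⁻¹ * g⁻¹)) :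
    map g (map h x) = map (g * h) x

namespace PartialAction

variable {G X : Type*} [Group G] [TopologicalSpace X] (φ : PartialAction G X)

theorem isOpen_set (g : G) : IsOpen (φ.set g) := φ.target_map g ▸ (φ.map g).open_target

theorem map_mem {g : G} {x : X} (hx : x ∈ φ.set g⁻¹) : φ.map g x ∈ φ.set g := by
  rw [← φ.target_map]
  exact (φ.map g).map_source (by rwa [φ.source_map])

theorem map_mem_inter {g h : G} {x : X} (hx : x ∈ φ.set g⁻¹) (hx' : x ∈ φ.set h) :
    φ.map g x ∈ φ.set (g * h) :=
  ((φ.map_image g h).subset ⟨x, ⟨hx, hx'⟩, rfl⟩).2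

theorem map_inv_mem {g : G} {x : X} (hx : x ∈ φ.set g) : φ.map g⁻¹ x ∈ φ.set g⁻¹ :=
  φ.map_mem (by rwa [inv_inv])

theorem map_map_inv {g : G} {x : X} (hx : x ∈ φ.set g) : φ.map g (φ.map g⁻¹ x) = x := by
  rw [φ.map_map g g⁻¹ x ⟨by rwa [inv_inv], by simp [φ.set_one]⟩, mul_inv_cancel, φ.map_one]

theorem map_inv_map {g : G} {x : X} (hx : x ∈ φ.set g⁻¹) : φ.map g⁻¹ (φ.map g x) = x := by
  have h := φ.map_map_inv hx
  rwa [inv_inv] at h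

theorem map_inv_mem_of_mem {g h : G} {x : X} (hx : x ∈ φ.set g) (hx' : x ∈ φ.set h) :
    φ.map g⁻¹ x ∈ φ.set (g⁻¹ * h) :=
  φ.map_mem_inter (by rwa [inv_inv]) hx'

/-- The groupoid `𝒢_X = ⋃_g {g} × X_g` of a partial action, with the topology inherited from the
product topology on `G × X`. -/
abbrev Arrows : Type _ := {p : G × X // p.2 ∈ φ.set p.1}

namespace Arrows

variable {φ}

theorem mul_mem (a b : φ.Arrows) (h : φ.map a.1.1⁻¹ a.1.2 = b.1.2) :
    a.1.2 ∈ φ.set (a.1.1 * b.1.1) := by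
  have h1 : φ.map a.1.1⁻¹ a.1.2 ∈ φ.set b.1.1 := h ▸ b.2
  have h2 := φ.map_mem_inter (φ.map_inv_mem a.2) h1
  rwa [φ.map_map_inv a.2] at h2

theorem map_mul_inv (a b : φ.Arrows) (h : φ.map a.1.1⁻¹ a.1.2 = b.1.2) :
    φ.map (a.1.1 * b.1.1)⁻¹ a.1.2 = φ.map b.1.1⁻¹ b.1.2 := by
  rw [← h, mul_inv_rev, φ.map_map]
  have h1 := mul_mem a b h
  have h2 := a.2
  exact ⟨by rwa [inv_inv], by rwa [inv_inv, inv_inv]⟩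

theorem ext_pair {a b : φ.Arrows} (h1 : a.1.1 = b.1.1) (h2 : a.1.2 = b.1.2) : a = b :=
  Subtype.ext (Prod.ext h1 h2)

/-- `d(g, x) = (1, φ_{g⁻¹}(x))`, `r(g, x) = (1, x)`, `(g, x)(h, y) = (gh, x)` and
`(g, x)⁻¹ = (g⁻¹, φ_{g⁻¹}(x))`. -/
instance : ArrowGroupoid φ.Arrows where
  inv a := ⟨(a.1.1⁻¹, φ.map a.1.1⁻¹ a.1.2), φ.map_inv_mem a.2⟩
  dom a := ⟨(1, φ.map a.1.1⁻¹ a.1.2), by simp [φ.set_one]⟩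
  ran a := ⟨(1, a.1.2), by simp [φ.set_one]⟩
  comp a b h := ⟨(a.1.1 * b.1.1, a.1.2), mul_mem a b (congrArg (fun c => c.1.2) h)⟩
  dom_comp a b h := ext_pair rfl (map_mul_inv a b (congrArg (fun c => c.1.2) h))
  ran_comp a b h := rfl
  comp_assoc a b c hab hbc := ext_pair (mul_assoc _ _ _) rfl
  ran_dom a := rfl
  dom_ran a := ext_pair rfl (by simp [φ.map_one])
  comp_dom a := ext_pair (mul_one _) rfl
  ran_comp_self a := ext_pair (one_mul _) rfl
  dom_inv a := ext_pair rfl (by simpa using φ.map_map_inv a.2)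
  ran_inv a := rfl
  inv_comp a := ext_pair (inv_mul_cancel _) rfl
  comp_inv a := ext_pair (mul_inv_cancel _) rfl

theorem domUnit_eq : (domUnit : φ.Arrows → units φ.Arrows) = fun a => ranUnit a⁻¹ :=
  funext fun a => Subtype.ext (ran_inv a).symm

theorem inv_inv' (a : φ.Arrows) : (a⁻¹)⁻¹ = a :=
  ext_pair (inv_inv _) (by
    change φ.map (a.1.1⁻¹)⁻¹ (φ.map a.1.1⁻¹ a.1.2) = a.1.2
    rw [inv_inv, φ.map_map_inv a.2])

variable [TopologicalSpace G]

theorem continuous_pair : Continuous (Subtype.val : φ.Arrows → G × X) := continuous_subtype_val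

theorem continuous_ranUnit : Continuous (ranUnit : φ.Arrows → units φ.Arrows) :=
  ((continuous_const.prodMk (continuous_snd.comp continuous_pair)).subtype_mk _).subtype_mk _

variable [DiscreteTopology G]

theorem isOpen_degree (g : G) : IsOpen {a : φ.Arrows | a.1.1 = g} :=
  (isOpen_discrete {g}).preimage (continuous_fst.comp continuous_pair)

theorem continuous_mapInv :
    Continuous fun a : φ.Arrows => φ.map a.1.1⁻¹ a.1.2 := by
  rw [continuous_iff_continuousAt]
  intro a
  have h : (fun b : φ.Arrows => φ.map b.1.1⁻¹ b.1.2) =ᶠ[𝓝 a]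
      fun b => φ.map a.1.1⁻¹ b.1.2 := by
    filter_upwards [(isOpen_degree a.1.1).mem_nhds rfl] with b hb
    rw [show b.1.1 = a.1.1 from hb]
  refine ContinuousAt.congr ?_ h.symm
  have ha : a.1.2 ∈ (φ.map a.1.1⁻¹).source := by
    rw [φ.source_map, inv_inv]; exact a.2
  exact ContinuousAt.comp (f := fun b : φ.Arrows => b.1.2)
    ((φ.map a.1.1⁻¹).continuousAt ha) (continuous_snd.comp continuous_pair).continuousAt

instance : IsTopological φ.Arrows where
  continuous_inv := ((continuous_of_discreteTopology.comp
    (continuous_fst.comp continuous_pair)).prodMk continuous_mapInv).subtype_mk _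
  continuous_comp := by
    have h1 : Continuous fun p : {p : φ.Arrows × φ.Arrows // dom p.1 = ran p.2} => p.1.1.1 :=
      continuous_pair.comp (continuous_fst.comp continuous_subtype_val)
    have h2 : Continuous fun p : {p : φ.Arrows × φ.Arrows // dom p.1 = ran p.2} => p.1.2.1 :=
      continuous_pair.comp (continuous_snd.comp continuous_subtype_val)
    have h3 : Continuous fun q : G × G => q.1 * q.2 := continuous_of_discreteTopology
    exact Continuous.subtype_mk
      ((h3.comp ((continuous_fst.comp h1).prodMk (continuous_fst.comp h2))).prodMk
        (continuous_snd.comp h1)) _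

theorem isOpen_carrier : IsOpen {p : G × X | p.2 ∈ φ.set p.1} := by
  have : {p : G × X | p.2 ∈ φ.set p.1} = ⋃ g, Prod.fst ⁻¹' {g} ∩ Prod.snd ⁻¹' φ.set g := by
    ext ⟨g, x⟩; simp
  rw [this]
  exact isOpen_iUnion fun g => ((isOpen_discrete {g}).preimage continuous_fst).inter
    ((φ.isOpen_set g).preimage continuous_snd)

theorem isOpenMap_ranUnit : IsOpenMap (ranUnit : φ.Arrows → units φ.Arrows) := by
  intro O hO
  have h1 : IsOpen ((fun a : φ.Arrows => a.1.2) '' O) :=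
    (isOpenMap_snd.comp isOpen_carrier.isOpenMap_subtype_val) O hO
  have h2 : ranUnit '' O =
      (fun u : units φ.Arrows => u.1.1.2) ⁻¹' ((fun a : φ.Arrows => a.1.2) '' O) := by
    ext u
    constructor
    · rintro ⟨a, ha, rfl⟩
      exact ⟨a, ha, rfl⟩
    · rintro ⟨a, ha, hau⟩
      refine ⟨a, ha, Subtype.ext (ext_pair ?_ hau)⟩
      obtain ⟨u, b, rfl⟩ := u
      rfl
  have h3 : Continuous fun u : units φ.Arrows => u.1.1.2 :=
    continuous_snd.comp (continuous_pair.comp continuous_subtype_val)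
  rw [h2]
  exact h1.preimage h3

theorem isOpenMap_inv : IsOpenMap fun a : φ.Arrows => a⁻¹ := fun O hO => by
  have : (fun a : φ.Arrows => a⁻¹) '' O = (fun a : φ.Arrows => a⁻¹) ⁻¹' O := by
    ext a
    constructor
    · rintro ⟨b, hb, rfl⟩
      simpa [inv_inv'] using hb
    · intro ha
      exact ⟨a⁻¹, ha, inv_inv' a⟩
  rw [this]
  exact hO.preimage IsTopological.continuous_inv

theorem isOpenBisection_of_degree {U : Set φ.Arrows} (hU : IsOpen U) {g : G}
    (hg : ∀ a ∈ U, a.1.1 = g) : IsOpenBisection U where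
  isOpen := hU
  isOpenEmbedding_dom := by
    refine .of_continuous_injective_isOpenMap ?_ ?_ ?_
    · rw [domUnit_eq]
      exact (continuous_ranUnit.comp IsTopological.continuous_inv).comp continuous_subtype_val
    · rintro ⟨a, ha⟩ ⟨b, hb⟩ hab
      have h1 : a.1.1 = b.1.1 := (hg a ha).trans (hg b hb).symm
      have h2 : φ.map a.1.1⁻¹ a.1.2 = φ.map b.1.1⁻¹ b.1.2 :=
        congrArg (fun u : units φ.Arrows => u.1.1.2) hab
      refine Subtype.ext (ext_pair h1 ?_)
      have h3 := φ.map_map_inv a.2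
      rw [h2, h1, φ.map_map_inv b.2] at h3
      exact h3.symm
    · rw [domUnit_eq]
      exact (isOpenMap_ranUnit.comp isOpenMap_inv).comp hU.isOpenMap_subtype_val
  isOpenEmbedding_ran := by
    refine .of_continuous_injective_isOpenMap (continuous_ranUnit.comp continuous_subtype_val)
      ?_ (isOpenMap_ranUnit.comp hU.isOpenMap_subtype_val)
    rintro ⟨a, ha⟩ ⟨b, hb⟩ hab
    exact Subtype.ext (ext_pair ((hg a ha).trans (hg b hb).symm)
      (congrArg (fun u : units φ.Arrows => u.1.1.2) hab))

instance [LocallyCompactSpace X] [T2Space X] [TotallyDisconnectedSpace X] :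
    IsAmple φ.Arrows where
  isLocalHomeomorph_dom := isLocalHomeomorph_iff_isOpenEmbedding_restrict.2 fun a =>
    ⟨_, (isOpen_degree a.1.1).mem_nhds rfl,
      (isOpenBisection_of_degree (isOpen_degree a.1.1) fun _ hb => hb).isOpenEmbedding_dom⟩
  isTopologicalBasis := by
    refine TopologicalSpace.isTopologicalBasis_of_isOpen_of_nhds (fun U hU => hU.2.isOpen) ?_
    rintro ⟨⟨g, x⟩, hx⟩ O hxO hO
    let ι : φ.set g → φ.Arrows := fun y => ⟨(g, y.1), y.2⟩
    have hι : Continuous ι := (continuous_const.prodMk continuous_subtype_val).subtype_mk _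
    have hW : IsOpen (Subtype.val '' (ι ⁻¹' O)) :=
      (φ.isOpen_set g).isOpenMap_subtype_val _ (hO.preimage hι)
    have hxW : x ∈ Subtype.val '' (ι ⁻¹' O) := ⟨⟨x, hx⟩, hxO, rfl⟩
    obtain ⟨L, hL, hxL, hLW⟩ := exists_compact_subset hW hxW
    obtain ⟨V, hV, hxV, hVL⟩ :=
      (loc_compact_Haus_tot_disc_of_zero_dim (H := X)).exists_subset_of_mem_open hxL
        isOpen_interior
    have hVc : IsCompact V := hL.of_isClosed_subset hV.isClosed (hVL.trans interior_subset)
    have hVW : V ⊆ Subtype.val '' (ι ⁻¹' O) := (hVL.trans interior_subset).trans hLW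
    have hVg : V ⊆ φ.set g := fun y hy => by
      obtain ⟨z, -, rfl⟩ := hVW hy
      exact z.2
    have hUeq : ι '' (Subtype.val ⁻¹' V) = {a : φ.Arrows | a.1.1 = g} ∩
        (fun a : φ.Arrows => a.1.2) ⁻¹' V := by
      ext a
      constructor
      · rintro ⟨y, hy, rfl⟩
        exact ⟨rfl, hy⟩
      · rintro ⟨rfl, ha⟩
        exact ⟨⟨a.1.2, a.2⟩, ha, rfl⟩
    have hUo : IsOpen (ι '' (Subtype.val ⁻¹' V)) := by
      rw [hUeq]
      exact (isOpen_degree g).inter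
        (hV.isOpen.preimage (continuous_snd.comp continuous_pair))
    refine ⟨ι '' (Subtype.val ⁻¹' V), ⟨?_, ?_⟩, ⟨⟨x, hx⟩, hxV, rfl⟩, ?_⟩
    · refine IsCompact.image ?_ hι
      rw [IsInducing.subtypeVal.isCompact_iff, Subtype.image_preimage_coe,
        inter_eq_right.2 hVg]
      exact hVc
    · refine isOpenBisection_of_degree (g := g) hUo ?_
      rintro _ ⟨y, -, rfl⟩
      rfl
    · rintro _ ⟨y, hy, rfl⟩
      obtain ⟨z, hz, hzy⟩ := hVW hy
      rwa [← Subtype.ext hzy]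

end Arrows

/-- The canonical grading `(g, x) ↦ g` of `𝒢_X`. -/
def grading [TopologicalSpace G] : GroupoidGrading φ.Arrows G where
  toFun a := a.1.1
  continuous_toFun := continuous_fst.comp continuous_subtype_val
  map_comp _ _ _ := rfl

end PartialAction

/-! ### The grading of a Steinberg algebra by a continuous cocycle -/

namespace ArrowGroupoid

variable {𝒢 : Type*} [ArrowGroupoid 𝒢]

/-! The grading exists for any ample Hausdorff groupoid with a continuous cocycle into a discrete
group. Degree slices are clopen, so cutting a function down to a set of degrees keeps it in the
algebra. A compact support meets only finitely many degrees, which gives the spanning, and functions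
of different degrees have disjoint supports, which gives the independence. The cocycle identity
gives the multiplicativity (`SteinbergAlgebra.isGroupGraded`).

Regularity uses the special shape of the transformation groupoid. An arrow `(g, x)` of fixed degree
`g` is determined by its range `x`, and also by its domain, since each partial homeomorphism is
injective. Hence a homogeneous `f` behaves like a monomial matrix: at most one nonzero entry in each
row and each column. Transposing and inverting the nonzero entries gives the quasi-inverse `f'(a) =
(f a⁻¹)⁻¹`. This lies in the algebra because inversion is a homeomorphism and `0⁻¹ = 0`, and both
sums in `f * (f' * f)` collapse to one term (`groupoidConv_inv_self`). -/

theorem leftDiv_inv_leftDiv (a c : 𝒢) (h : ran a = ran c)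
    (h' : ran a⁻¹ = ran (leftDiv a c h)) : leftDiv a⁻¹ (leftDiv a c h) h' = c := by
  have h1 := comp_assoc a⁻¹⁻¹ a⁻¹ c (dom_inv a⁻¹) ((dom_inv a).trans h)
  refine h1.symm.trans ((comp_congr ?_ rfl _ (dom_ran c)).trans (ran_comp_self c))
  exact (inv_comp a⁻¹).trans ((dom_inv a).trans h)

end ArrowGroupoid

/-! ### Quasi-inverses for convolution. -/

section Regular

variable {K 𝒢 : Type*} [Field K] [ArrowGroupoid 𝒢]

/-- A function supported on a set where the domain and range maps are injective is von Neumann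
regular for the convolution product, with quasi-inverse `a ↦ (f a⁻¹)⁻¹`. -/
theorem groupoidConv_inv_self {f : 𝒢 → K} (hr : InjOn ran (Function.support f))
    (hd : InjOn dom (Function.support f)) (hinv : ∀ a : 𝒢, a⁻¹⁻¹ = a) :
    groupoidConv f (groupoidConv (fun a => (f a⁻¹)⁻¹) f) = f := by
  funext c
  rw [groupoidConv_apply]
  -- The case split is on whether the row of `c` contains a support point `a`. In the first case `f
  -- c` may still be zero: the computation ends in `f a * (f a)⁻¹ * f c` whatever its value.
  by_cases hc : ∃ a, ran a = ran c ∧ f a ≠ 0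
  · obtain ⟨a, hac, ha⟩ := hc
    rw [finsum_eq_single _ (⟨a, hac⟩ : {a : 𝒢 // ran a = ran c}), groupoidConv_apply]
    · have h : ran a⁻¹ = ran (leftDiv a c hac) := by rw [ran_inv, ran_leftDiv]
      -- With `a` fixed, the inner sum runs over `b` with range `dom a`. Its term at `b` involves `f
      -- b⁻¹`, where `b⁻¹` has the same domain as `a`, so injectivity of `dom` on the support leaves
      -- only `b = a⁻¹`.
      rw [finsum_eq_single _ (⟨a⁻¹, h⟩ : {b : 𝒢 // ran b = ran (leftDiv a c hac)})]
      · simp only [leftDiv_inv_leftDiv a c hac h, hinv]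
        rw [← mul_assoc, mul_inv_cancel₀ ha, one_mul]
      · rintro ⟨b, hb⟩ hba
        have : f b⁻¹ = 0 := by
          by_contra hfb
          refine hba (Subtype.ext ?_)
          have h1 : b⁻¹ = a := hd hfb ha (by rw [dom_inv, hb, ran_leftDiv])
          exact (hinv b).symm.trans (congrArg _ h1)
        -- The convention `0⁻¹ = 0` makes the quasi-inverse vanish at `b`.
        simp [this]
    · rintro ⟨b, hb⟩ hba
      have : f b = 0 := by
        by_contra hfb
        exact hba (Subtype.ext (hr hfb ha (hb.trans hac.symm)))
      simp [this]
  · push Not at hc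
    -- The arrow `c` lies in its own row, so the right-hand side vanishes as well.
    rw [hc c rfl]
    refine (finsum_congr fun a => ?_).trans finsum_zero
    rw [hc a.1 a.2, zero_mul]

end Regular

/-! ### The direct sum decomposition by degree. -/

namespace GroupoidGrading

variable {𝒢 G : Type*} [ArrowGroupoid 𝒢] [TopologicalSpace 𝒢] [Group G] [TopologicalSpace G]
  [DiscreteTopology G]

/-- Discreteness of the group is what lets restriction to a set of degrees preserve local constancy.
-/
theorem isClopen_preimage (c : GroupoidGrading 𝒢 G) (S : Set G) : IsClopen (c.toFun ⁻¹' S) :=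
  (isClopen_discrete S).preimage c.continuous_toFun

end GroupoidGrading

namespace SteinbergAlgebra

variable {R 𝒢 G : Type*} [CommRing R] [ArrowGroupoid 𝒢] [TopologicalSpace 𝒢] [Group G]
  [TopologicalSpace G]

theorem mem_homogeneousComponent {c : GroupoidGrading 𝒢 G} {g : G} {f : SteinbergAlgebra R 𝒢} :
    f ∈ homogeneousComponent R c g ↔ ∀ a, f a ≠ 0 → c.toFun a = g := Iff.rfl

variable (R) in
/-- The functions vanishing on the arrows of degree `g`. -/
def vanishingComponent (c : GroupoidGrading 𝒢 G) (g : G) : Submodule R (SteinbergAlgebra R 𝒢) where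
  carrier := {f | ∀ a, c.toFun a = g → f a = 0}
  add_mem' {f f'} hf hf' a ha := by simp [coe_add, hf a ha, hf' a ha]
  zero_mem' a _ := by simp [coe_zero]
  smul_mem' k f hf a ha := by simp [coe_smul, hf a ha]

/-- Vanishing in degree `g` is a linear condition met by every component of another degree, hence by
their supremum. No explicit finite sums are needed. -/
theorem iSupIndep_homogeneousComponent (c : GroupoidGrading 𝒢 G) :
    iSupIndep (homogeneousComponent R c) := by
  intro g
  have hle : ⨆ h, ⨆ (_ : h ≠ g), homogeneousComponent R c h ≤ vanishingComponent R c g := by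
    refine iSup₂_le fun h hhg f hf a ha => ?_
    by_contra hfa
    exact hhg ((mem_homogeneousComponent.1 hf a hfa).symm.trans ha)
  refine Disjoint.mono_right hle (Submodule.disjoint_def.2 fun f hf hf' => ext_fun ?_)
  funext a
  by_contra hfa
  exact hfa (hf' a (mem_homogeneousComponent.1 hf a hfa))

variable [DiscreteTopology G]

/-- The restriction of `f` to the arrows with degree in `S`, extended by zero. -/
noncomputable def restrictDegree (c : GroupoidGrading 𝒢 G) (S : Set G)
    (f : SteinbergAlgebra R 𝒢) : SteinbergAlgebra R 𝒢 :=
  mk ((c.toFun ⁻¹' S).indicator f)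
    (f.isLocallyConstant.indicator_of_isClopen (c.isClopen_preimage S))
    (f.hasCompactSupport.indicator_set _)

/-- For finitely many degrees the restriction is the sum of its homogeneous pieces, peeled off one
degree at a time. -/
theorem restrictDegree_mem_iSup (c : GroupoidGrading 𝒢 G) (f : SteinbergAlgebra R 𝒢)
    (S : Finset G) : restrictDegree c S f ∈ ⨆ g, homogeneousComponent R c g := by
  classical
  induction S using Finset.induction_on with
  | empty =>
    convert Submodule.zero_mem _
    refine ext_fun ?_
    simp only [restrictDegree, coe_mk, Finset.coe_empty, preimage_empty, indicator_empty']
    rfl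
  | insert g S hg ih =>
    have hsplit : restrictDegree c (insert g S : Finset G) f =
        restrictDegree c {g} f + restrictDegree c S f := by
      refine ext_fun ?_
      rw [coe_add]
      simp only [restrictDegree, coe_mk, Finset.coe_insert, insert_eq, preimage_union]
      exact indicator_union_of_disjoint
        ((disjoint_singleton_left.2 (by exact_mod_cast hg)).preimage _) _
    rw [hsplit]
    refine add_mem (Submodule.mem_iSup_of_mem g ?_) ih
    intro a ha
    exact mem_of_indicator_ne_zero ha

theorem iSup_homogeneousComponent (c : GroupoidGrading 𝒢 G) :
    ⨆ g, homogeneousComponent R c g = ⊤ := by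
  refine eq_top_iff.2 fun f _ => ?_
  -- A compact subset of a discrete group is finite.
  have hfin : (c.toFun '' tsupport (f : 𝒢 → R)).Finite :=
    (IsCompact.image f.hasCompactSupport c.continuous_toFun).finite_of_discrete
  have h : restrictDegree c hfin.toFinset f = f := by
    refine ext_fun ?_
    rw [restrictDegree, coe_mk, indicator_eq_self, hfin.coe_toFinset]
    exact fun a ha => ⟨a, subset_tsupport _ ha, rfl⟩
  rw [← h]
  exact restrictDegree_mem_iSup c f _

theorem isGroupGraded [IsAmple 𝒢] [T2Space 𝒢] (c : GroupoidGrading 𝒢 G) :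
    IsGroupGraded (homogeneousComponent R c) where
  mul_mem g h x y hx hy e he := by
    rw [Function.mem_support, coe_mul] at he
    -- A support point of a product factors through support points of the two factors.
    obtain ⟨a, b, hab, rfl, ha, hb⟩ := groupoidConv_support_subset _ _ e he
    change c.toFun _ = g * h
    rw [c.map_comp, mem_homogeneousComponent.1 hx a ha, mem_homogeneousComponent.1 hy b hb]
  isInternal := by
    classical
    exact (DirectSum.isInternal_submodule_iff_iSupIndep_and_iSup_eq_top _).2
      ⟨iSupIndep_homogeneousComponent c, iSup_homogeneousComponent c⟩

end SteinbergAlgebra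

/-! ### Degree slices of the transformation groupoid. -/

namespace PartialAction.Arrows

variable {G X : Type*} [Group G] [TopologicalSpace X] {φ : PartialAction G X}

theorem injOn_ran_degree (g : G) : InjOn ran {a : φ.Arrows | a.1.1 = g} := by
  intro a ha b hb hab
  have h : (ran a).1.2 = (ran b).1.2 := by rw [hab]
  exact ext_pair (ha.trans hb.symm) h

/-- Inversion exchanges domain and range and carries degree `g` to degree `g⁻¹`, so this reduces to
`injOn_ran_degree`. -/
theorem injOn_dom_degree (g : G) : InjOn dom {a : φ.Arrows | a.1.1 = g} := by
  intro a ha b hb hab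
  have h : a⁻¹ = b⁻¹ := injOn_ran_degree g⁻¹ (congrArg (·⁻¹) ha) (congrArg (·⁻¹) hb)
    (by rw [ran_inv, ran_inv, hab])
  rw [← inv_inv' a, h, inv_inv']

/-- Inversion as a homeomorphism of the groupoid. -/
def invHomeomorph [TopologicalSpace G] [DiscreteTopology G] : φ.Arrows ≃ₜ φ.Arrows where
  toFun a := a⁻¹
  invFun a := a⁻¹
  left_inv := inv_inv'
  right_inv := inv_inv'
  continuous_toFun := IsTopological.continuous_inv
  continuous_invFun := IsTopological.continuous_inv

end PartialAction.Arrows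

theorem mainTheorem7 {G X K : Type*} [Group G] [TopologicalSpace G] [DiscreteTopology G]
    [TopologicalSpace X] [LocallyCompactSpace X] [T2Space X] [TotallyDisconnectedSpace X]
    [Field K] (φ : PartialAction G X) :
    IsGradedVonNeumannRegular
      (fun g : G => SteinbergAlgebra.homogeneousComponent K φ.grading g) := by
  refine { SteinbergAlgebra.isGroupGraded φ.grading with regular := fun g f hf => ?_ }
  have hlc : IsLocallyConstant fun a : φ.Arrows => (f a⁻¹)⁻¹ :=
    (f.isLocallyConstant.comp_continuous IsTopological.continuous_inv).comp (·⁻¹)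
  -- Pulling back along the inversion homeomorphism preserves compact support, and inverting values
  -- creates no new support because `0⁻¹ = 0`.
  have hcs : HasCompactSupport fun a : φ.Arrows => (f a⁻¹)⁻¹ :=
    (f.hasCompactSupport.comp_homeomorph PartialAction.Arrows.invHomeomorph).comp_left
      (g := fun k : K => k⁻¹) inv_zero
  refine ⟨SteinbergAlgebra.mk _ hlc hcs, ?_⟩
  rw [mul_assoc]
  -- By definition of the canonical grading, `hf` places the support of `f` in the slice `a.1.1 =
  -- g`, where both `ran` and `dom` are injective.
  exact SteinbergAlgebra.ext_fun (groupoidConv_inv_self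
    ((PartialAction.Arrows.injOn_ran_degree g).mono hf)
    ((PartialAction.Arrows.injOn_dom_degree g).mono hf) PartialAction.Arrows.inv_inv')
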